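/- Setting. Let $\mathbb F$ be a field of characteristic $p$ (a prime or $0$), let $n\ge 1$, let $\mathbb U_1,\dots,\mathbb U_n$ be finite sets with $u_a=|\mathbb U_a|\ge 2$, and let $\mathbb X=\mathbb U_1\times\cdots\times\mathbb U_n$, $d=2^n-1$. For $g\in[0,d]$ let $\mathbb P(g)\subseteq\{1,\dots,n\}$ be the set of positions of the digits $1$ in the binary expansion of $g$ (position $a$ belonging to $2^{a-1}$). For $g,h\in[0,d]$ write $g\le_2 h$ if $\mathbb P(g)\subseteq\mathbb P(h)$; let $g\cap h,\ g\cup h,\ g\setminus h\in[0,d]$ be the numbers whose sets $\mathbb P$ are $\mathbb P(g)\cap\mathbb P(h)$, $\mathbb P(g)\cup\mathbb P(h)$, $\mathbb P(g)\setminus\mathbb P(h)$; let $\widetilde g$ be the number with $\mathbb P(\widetilde g)=\{a\in\mathbb P(g):u_a>2\}$; and put $g\oplus h=(g\setminus h)\cup(h\setminus g)$, $g\odot h=(g\oplus h)\cup\widetilde{g\cap h}$. The factorial scheme with the parameters $u_1,\dots,u_n$ is the association scheme $\{R_0,\dots,R_d\}$ on $\mathbb X$ in which $(\mathbf y,\mathbf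 z)\in R_g$ if and only if $\{a:\mathbf y_a\ne\mathbf z_a\}=\mathbb P(g)$. Let $p_{gh}^i$ be its intersection numbers and $k_g=p_{gg}^0$ its valencies; for an integer $c$ let $\overline c$ be its image in $\mathbb F$. Let $A_g$ be the adjacency matrix of $R_g$ over $\mathbb F$, fix $\mathbf x\in\mathbb X$, and let $E_g^*$ be the diagonal $\{0,1\}$-matrix over $\mathbb F$ whose $(\mathbf y,\mathbf y)$-entry is $1$ if and only if $(\mathbf x,\mathbf y)\in R_g$. If $p_{gh}^i\ne 0$, put $B_{g,h,i}=\sum_{g\oplus i\le_2 j\le_2 h}E_g^*A_jE_i^*$. If moreover $p\nmid k_h$, then $D_{g,h,i}$ is said to be defined, and $$D_{g,h,i}=\sum_{k=0}^{n_{h,g\odot i}}\ \sum_{m\in\mathbb U_{h,g\odot i,k}}(\overline{-1})^k\,\overline{k_{i\cap m}}^{\,-1}B_{g,m,i},$$ where $n_{h,j}=|\{a\in\mathbb P(j)\setminus\mathbb P(h):u_a\not\equiv 1\pmod p\}|$ and $\mathbb U_{h,j,k}=\{a: h\le_2 a\le_2 j,\ p\nmid k_a,\ |\mathbb P(a)|-|\mathbb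 P(h)|=k\}$. Theorem 8.10 (with the companion Theorem 8.9). Let $g,h,i,j,k,\ell\in[0,d]$ satisfy $p_{gh}^i\ne 0$, $p_{jk}^\ell\ne 0$ and $p\nmid k_hk_k$, and let $m=(i\oplus j)\cup(\widetilde{i\cap j}\cap h)$. (1) $D_{j,k,\ell}D_{g,h,i}\ne 0$ if and only if $g=\ell$, $\widetilde{g\cap i}\setminus h\le_2 j$, and $k=(g\oplus j)\cup(\widetilde{g\cap j}\cap h)$. In that case $D_{j,m,i}$ is defined and $D_{j,k,g}D_{g,h,i}=D_{j,m,i}$. (2) $B_{j,k,\ell}D_{g,h,i}\ne 0$ if and only if $g=\ell$ and $\widetilde{g\cap i}\cap k\le_2 h$. In that case $D_{j,m,i}$ is defined and $B_{j,k,g}D_{g,h,i}=\overline{k_{g\cap k}}\,D_{j,m,i}$. -/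

import Mathlib

/-- An association scheme on the finite set `X` with the `N = d + 1` relations
`R 0, R 1, …, R d`. -/
structure AssociationScheme (X : Type*) [Fintype X] (N : ℕ) [NeZero N] where
  /-- `R g y z` means that the pair `(y, z)` lies in the relation `R_g`. -/
  R : Fin N → X → X → Prop
  /-- The relations are nonempty … -/
  nonempty : ∀ g, ∃ y z, R g y z
  /-- … and they partition `X × X`. -/
  partition : ∀ y z, ∃! g, R g y z
  /-- `R_0` is the diagonal. -/
  diag : ∀ y z, R 0 y z ↔ y = z
  /-- The converse of a relation of the scheme is a relation of the scheme. -/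
  converse : ∀ g, ∃ g', ∀ y z, R g' y z ↔ R g z y
  /-- The number of `a` with `(y, a) ∈ R_g` and `(a, z) ∈ R_h` depends only on the relation
  that contains `(y, z)`. -/
  regular : ∀ g h i y z y' z', R i y z → R i y' z' →
    Nat.card {a // R g y a ∧ R h a z} = Nat.card {a // R g y' a ∧ R h a z'}

namespace AssociationScheme

variable {X : Type*} [Fintype X] {N : ℕ} [NeZero N] (S : AssociationScheme X N)

/-- The intersection number `p_{gh}^i`: the number of `a` with `(y, a) ∈ R_g` and
`(a, z) ∈ R_h`, for one (equivalently, every) pair `(y, z) ∈ R_i`. -/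
noncomputable def interNum (g h i : Fin N) : ℕ :=
  Nat.card {a // S.R g (S.nonempty i).choose a ∧ S.R h a (S.nonempty i).choose_spec.choose}

theorem interNum_eq {g h i : Fin N} {y z : X} (hyz : S.R i y z) :
    S.interNum g h i = Nat.card {a // S.R g y a ∧ S.R h a z} :=
  S.regular g h i _ _ y z (S.nonempty i).choose_spec.choose_spec hyz

/-- The index `g'` of the converse of `R_g`. -/
noncomputable def conv (g : Fin N) : Fin N := (S.converse g).choose

/-- The valency `k_g = p_{gg'}^0`. -/
noncomputable def valency (g : Fin N) : ℕ := S.interNum g (S.conv g) 0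

open Classical in
/-- The adjacency matrix `A_g` over `F`. -/
noncomputable def adj (F : Type*) [Field F] (g : Fin N) : Matrix X X F :=
  Matrix.of fun y z => if S.R g y z then 1 else 0

open Classical in
/-- The dual idempotent `E_g^*(x)` over `F`. -/
noncomputable def dualIdem (F : Type*) [Field F] (x : X) (g : Fin N) : Matrix X X F :=
  Matrix.diagonal fun y => if S.R g x y then 1 else 0

end AssociationScheme

namespace Factorial

/-! ### The numbers `0, 1, …, 2^n - 1` as subsets

The coordinates `1, …, n` are labelled here by `Fin n`, that is by `0, …, n - 1`. -/

section Index

variable {n : ℕ}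

/-- `ℙ(g)`: the positions of the digits `1` in the binary expansion of `g`. -/
def bits (g : Fin (2 ^ n)) : Finset (Fin n) :=
  Finset.univ.filter fun a => g.val.testBit a.val = true

/-- The number `g` with `ℙ(g) = s`. -/
def ofBits (s : Finset (Fin n)) : Fin (2 ^ n) :=
  ⟨∑ a ∈ s.map Fin.valEmbedding, 2 ^ a,
    Nat.geomSum_lt le_rfl (by
      intro k hk
      obtain ⟨a, -, rfl⟩ := Finset.mem_map.1 hk
      exact a.isLt)⟩

theorem bits_ofBits (s : Finset (Fin n)) : bits (ofBits s) = s := by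
  ext a
  have h1 := Finset.toFinset_bitIndices_sum_two_pow (s.map Fin.valEmbedding)
  have h2 : a.val ∈ (∑ b ∈ s.map Fin.valEmbedding, 2 ^ b).bitIndices.toFinset ↔ a ∈ s := by
    rw [h1]
    simp [Fin.val_inj]
  rw [← h2]
  simp [bits, ofBits]

theorem bits_injective : Function.Injective (bits (n := n)) := by
  intro g h hgh
  refine Fin.ext (Nat.eq_of_testBit_eq fun a => ?_)
  by_cases ha : a < n
  · have h1 := Finset.ext_iff.1 hgh ⟨a, ha⟩
    simp only [bits, Finset.mem_filter, Finset.mem_univ, true_and] at h1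
    exact Bool.eq_iff_iff.2 h1
  · have h2 : 2 ^ n ≤ 2 ^ a := Nat.pow_le_pow_right (by norm_num) (not_lt.1 ha)
    rw [Nat.testBit_lt_two_pow (g.isLt.trans_le h2), Nat.testBit_lt_two_pow (h.isLt.trans_le h2)]

/-- `g ≤₂ h`. -/
def LE2 (g h : Fin (2 ^ n)) : Prop := bits g ⊆ bits h

/-- `g ∖ h`. -/
def diff (g h : Fin (2 ^ n)) : Fin (2 ^ n) := ofBits (bits g \ bits h)

/-- `g ∪ h`. -/
def cup (g h : Fin (2 ^ n)) : Fin (2 ^ n) := ofBits (bits g ∪ bits h)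

/-- `g ∩ h`. -/
def cap (g h : Fin (2 ^ n)) : Fin (2 ^ n) := ofBits (bits g ∩ bits h)

/-- `g ⊕ h = (g ∖ h) ∪ (h ∖ g)`. -/
def oplus (g h : Fin (2 ^ n)) : Fin (2 ^ n) := cup (diff g h) (diff h g)

end Index

/-! ### Factorial schemes and their Terwilliger algebras -/

variable {n : ℕ} (U : Fin n → Type*) [∀ a, Fintype (U a)]

/-- `g̃`: the number whose set of digits `ℙ(g̃)` is `ℙ₂(g) = {a ∈ ℙ(g) : u_a > 2}`. -/
def tilde (g : Fin (2 ^ n)) : Fin (2 ^ n) :=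
  ofBits ((bits g).filter fun a => 2 < Fintype.card (U a))

/-- `g ⊙ h = (g ⊕ h) ∪ (g ∩ h)~`. -/
def odot (g h : Fin (2 ^ n)) : Fin (2 ^ n) := cup (oplus g h) (tilde U (cap g h))

variable {U}

/-- The factorial scheme with the parameters `u_a = |U a| ≥ 2`: the points are the vectors in the
product of the sets `U a`, and `(y, z)` lies in `R_g` if `y` and `z` differ exactly in the
coordinates in `ℙ(g)`. -/
def scheme (hU : ∀ a, 2 ≤ Fintype.card (U a)) : AssociationScheme (∀ a, U a) (2 ^ n) where
  R g y z := ∀ a, y a ≠ z a ↔ a ∈ bits g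
  nonempty g := by
    have h1 : ∀ a, ∃ b c : U a, b ≠ c := fun a =>
      Fintype.exists_pair_of_one_lt_card (hU a)
    choose b c hbc using h1
    refine ⟨b, fun a => if a ∈ bits g then c a else b a, fun a => ?_⟩
    by_cases ha : a ∈ bits g <;> simp [ha, hbc a]
  partition y z := by
    classical
    refine ⟨ofBits (Finset.univ.filter fun a => y a ≠ z a), fun a => ?_, fun g hg => ?_⟩
    · simp [bits_ofBits]
    · apply bits_injective
      ext a
      rw [bits_ofBits, ← hg a]
      simp
  diag y z := by
    simp [bits, funext_iff]
  converse g := ⟨g, fun y z => forall_congr' fun a => by rw [ne_comm]⟩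
  regular g h i y z y' z' hyz hyz' := by
    classical
    have key : ∀ a, ∃ σ : Equiv.Perm (U a), σ (y a) = y' a ∧ σ (z a) = z' a := by
      intro a
      have hiff : y a ≠ z a ↔ y' a ≠ z' a := (hyz a).trans (hyz' a).symm
      refine ⟨(Equiv.swap (y a) (y' a)).trans
        (Equiv.swap (Equiv.swap (y a) (y' a) (z a)) (z' a)), ?_, by simp⟩
      by_cases hc : y a = z a
      · have hc' : y' a = z' a := by
          by_contra hne
          exact (hiff.2 hne) hc
        simp [← hc, ← hc']
      · have hc' : y' a ≠ z' a := hiff.1 hc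
        rw [Equiv.trans_apply, Equiv.swap_apply_left]
        refine Equiv.swap_apply_of_ne_of_ne (fun heq => hc ?_) hc'
        have := congrArg (Equiv.swap (y a) (y' a)) heq
        simpa using this
    choose σ hy hz using key
    refine Nat.card_congr ((Equiv.piCongrRight σ).subtypeEquiv fun w => ?_)
    refine and_congr (forall_congr' fun a => ?_) (forall_congr' fun a => ?_)
    · simp [← hy a]
    · simp [← hz a]

variable (hU : ∀ a, 2 ≤ Fintype.card (U a)) (F : Type*) [Field F] (x : ∀ a, U a)

open Classical in
/-- `B_{g,h,i} = ∑_{g ⊕ i ≤₂ j ≤₂ h} E_g^* A_j E_i^*` (used when `p_{gh}^i ≠ 0`). -/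
noncomputable def B (g h i : Fin (2 ^ n)) : Matrix (∀ a, U a) (∀ a, U a) F :=
  ∑ j ∈ Finset.univ.filter (fun j => LE2 (oplus g i) j ∧ LE2 j h),
    (scheme hU).dualIdem F x g * (scheme hU).adj F j * (scheme hU).dualIdem F x i

variable (U) in
/-- `n_{h,j} = |{a ∈ ℙ(j) ∖ ℙ(h) : u_a ≢ 1 mod p}|`. -/
def numFree (p : ℕ) (h j : Fin (2 ^ n)) : ℕ :=
  ((bits j \ bits h).filter fun a => ¬ Fintype.card (U a) ≡ 1 [MOD p]).card

open Classical in
/-- `𝕌_{h,j,k} = {a : h ≤₂ a ≤₂ j, p ∤ k_a, |ℙ(a)| - |ℙ(h)| = k}`. -/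
noncomputable def layer (p : ℕ) (h j : Fin (2 ^ n)) (k : ℕ) : Finset (Fin (2 ^ n)) :=
  Finset.univ.filter fun a => LE2 h a ∧ LE2 a j ∧ ¬ p ∣ (scheme hU).valency a ∧
    ((bits a).card : ℤ) - ((bits h).card : ℤ) = (k : ℤ)

/-- `D_{g,h,i} = ∑_{k=0}^{n_{h,g⊙i}} ∑_{m ∈ 𝕌_{h,g⊙i,k}} (-1)^k k_{i∩m}⁻¹ B_{g,m,i}`
(used when `p_{gh}^i ≠ 0` and `p ∤ k_h`), where `p` is the characteristic of `F`. -/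
noncomputable def D (p : ℕ) (g h i : Fin (2 ^ n)) : Matrix (∀ a, U a) (∀ a, U a) F :=
  ∑ k ∈ Finset.range (numFree U p h (odot U g i) + 1),
    ∑ m ∈ layer hU p h (odot U g i) k,
      ((-1 : F) ^ k * (((scheme hU).valency (cap i m) : ℕ) : F)⁻¹) • B hU F x g m i

/-- `D_{g,h,i}` is defined: `p_{gh}^i ≠ 0` and `p ∤ k_h`. -/
def DDefined (p : ℕ) (g h i : Fin (2 ^ n)) : Prop :=
  (scheme hU).interNum g h i ≠ 0 ∧ ¬ p ∣ (scheme hU).valency h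

end Factorial

open Factorial

/-! The scheme is a product of trivial schemes, so everything splits over coordinates: `B` and `D`
are tensor products of one-coordinate matrices (`B_eq_tensor`, `D_eq_tensor`), and the numerical
hypotheses and index formulas become digitwise conditions (`ValidBit`, `weight`, `composeBit`). A
tensor product is nonzero exactly when all its factors are (`tensor_ne_zero_iff`), so one coordinate
suffices.

Let `J` be an all-ones block between spheres about `o`, and `I` the identity on the points other
than `o`. For valid digits `block` is `J`, except for `g = i = 1`, `h = 0`, `u > 2`, where it is
`I`. Correspondingly `blockD` is `J` divided by the weight of `i`, or in the exceptional case `C = I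
- J/(u-1)`, read as `I` if `u - 1` vanishes in `F` (`blockD_eq`, `block_eq`). The products are `JJ =
weight • J`, `CC = IC = C`, and `CJ = JC = 0` when `u - 1` is invertible. Hence, between matching
spheres, a product vanishes exactly when `C` meets `J`, and the digit conditions of the theorem
exclude exactly this. -/

namespace Factorial

/-! ### One coordinate: blocks and their products -/

section Block

variable {V : Type*} [Fintype V] (F : Type*) [Field F] (o : V)

open Classical in
/-- The one-coordinate factor of `B_{g,h,i}`: the `{0,1}`-matrix of the pairs `(y, z)` with
`y ≠ o` iff `g`, `z ≠ o` iff `i`, and `y = z` unless `h`. -/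
noncomputable def block (g h i : Bool) : Matrix V V F :=
  Matrix.of fun y z => if (o ≠ y ↔ g = true) ∧ (o ≠ z ↔ i = true) ∧ (y ≠ z → h = true) then 1 else 0

/-- The valency `u - 1`, resp. `1`, of a relation of a trivial scheme on `V`, in `F`. -/
def weight (V : Type*) [Fintype V] (F : Type*) [Field F] (b : Bool) : F :=
  if b then (Fintype.card V : F) - 1 else 1

/-- The one-coordinate version of `g ⊙ i`. -/
def odotBit (V : Type*) [Fintype V] (g i : Bool) : Bool :=
  (g ^^ i) || ((g && i) && decide (2 < Fintype.card V))

/-- The one-coordinate factor of `D_{g,h,i}`. -/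
noncomputable def blockD (g h i : Bool) : Matrix V V F :=
  open Classical in
  ∑ b : Bool, if (h = true → b = true) ∧ (b = true → odotBit V g i = true) ∧ weight V F b ≠ 0 then
    ((if b = true ∧ h = false then -1 else 1) * (weight V F (i && b))⁻¹) • block F o g b i else 0

/-- The one-coordinate version of `p_{gh}^i ≠ 0`. -/
def ValidBit (V : Type*) [Fintype V] (g h i : Bool) : Prop :=
  ((g ^^ i) = true → h = true) ∧ (h = true → odotBit V g i = true)

theorem block_mul_of_ne {l g : Bool} (hlg : l ≠ g) (j k h i : Bool) :
    block F o j k l * block F o g h i = 0 := by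
  ext y z
  simp only [Matrix.mul_apply, block, Matrix.of_apply, Matrix.zero_apply]
  refine Finset.sum_eq_zero fun w _ => ?_
  rw [ite_zero_mul_ite_zero, if_neg]
  rintro ⟨⟨-, h1, -⟩, h2, -, -⟩
  exact hlg (Bool.eq_iff_iff.2 (h1.symm.trans h2))

theorem exists_mem_sphere (hV : 2 ≤ Fintype.card V) (g : Bool) : ∃ y : V, o ≠ y ↔ g = true := by
  cases g
  · exact ⟨o, by simp⟩
  · have : Nontrivial V := Fintype.one_lt_card_iff_nontrivial.1 hV
    obtain ⟨y, hy⟩ := exists_ne o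
    exact ⟨y, by simpa using hy.symm⟩

theorem block_full_ne_zero (hV : 2 ≤ Fintype.card V) (g i : Bool) : block F o g true i ≠ 0 := by
  obtain ⟨y, hy⟩ := exists_mem_sphere o hV g
  obtain ⟨z, hz⟩ := exists_mem_sphere o hV i
  intro h0
  have := congrFun (congrFun h0 y) z
  simp only [block, Matrix.of_apply, Matrix.zero_apply] at this
  rw [if_pos ⟨hy, hz, fun _ => rfl⟩] at this
  exact one_ne_zero this

open Classical in
theorem sum_sphere (g : Bool) :
    ∑ w : V, (if (o ≠ w ↔ g = true) then (1 : F) else 0) = weight V F g := by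
  cases g
  · simp [weight]
  · have : ∀ w : V, (if (o ≠ w ↔ true = true) then (1 : F) else 0) = 1 - if o = w then 1 else 0 := by
      intro w
      by_cases h : o = w <;> simp [h]
    rw [Finset.sum_congr rfl fun w _ => this w]
    simp [weight]

/-- Every point of the middle sphere contributes once, so the scalar is its size. -/
theorem block_full_mul (j g i : Bool) :
    block F o j true g * block F o g true i = weight V F g • block F o j true i := by
  classical
  ext y z
  rw [Matrix.smul_apply, ← sum_sphere F o g]
  simp only [Matrix.mul_apply, block, Matrix.of_apply, smul_eq_mul, Finset.sum_mul]
  refine Finset.sum_congr rfl fun w _ => ?_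
  by_cases h1 : (o ≠ y ↔ j = true) <;> by_cases h2 : (o ≠ z ↔ i = true) <;>
    by_cases h3 : (o ≠ w ↔ g = true) <;> simp only [h1, h2, h3] <;> simp

theorem block_id_mul (h i : Bool) :
    block F o true false true * block F o true h i = block F o true h i := by
  classical
  ext y z
  rw [Matrix.mul_apply, Finset.sum_eq_single y]
  · by_cases h1 : o = y <;> simp [block, h1]
  · intro w _ hw
    simp [block, hw.symm]
  · simp

theorem mul_block_id (j k : Bool) :
    block F o j k true * block F o true false true = block F o j k true := by
  classical
  ext y z
  rw [Matrix.mul_apply, Finset.sum_eq_single z]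
  · by_cases h1 : o = z <;> simp [block, h1]
  · intro w _ hw
    simp [block, hw]
  · simp

/-- The sphere of radius zero is `{o}`, where `y = z` is automatic. -/
theorem block_false_false (h : Bool) : block F o false h false = block F o false true false := by
  classical
  ext y z
  simp only [block, Matrix.of_apply]
  refine if_congr ?_ rfl rfl
  refine and_congr_right fun h1 => and_congr_right fun h2 => ?_
  have : y = z := by
    simp only [Bool.false_eq_true, iff_false, not_not] at h1 h2
    exact h1.symm.trans h2
  simp [this]

theorem block_id_eq_full (h2 : ¬ 2 < Fintype.card V) (h : Bool) :
    block F o true h true = block F o true true true := by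
  classical
  ext y z
  simp only [block, Matrix.of_apply]
  refine if_congr ?_ rfl rfl
  refine and_congr_right fun h1 => and_congr_right fun h3 => ?_
  have : y = z := by
    by_contra hne
    simp only [iff_true] at h1 h3
    exact h2 (Fintype.two_lt_card_iff.2 ⟨o, y, z, h1, h3, hne⟩)
  simp [this]

/-- The one-coordinate factor `D_{1,0,1}`: the complement of the averaging projection on
`V ∖ {o}` if `|V| - 1` is invertible, and the identity on `V ∖ {o}` otherwise. -/
noncomputable def coavg : Matrix V V F :=
  block F o true false true - (weight V F true)⁻¹ • block F o true true true

theorem coavg_ne_zero (h2 : 2 < Fintype.card V) : coavg F o ≠ 0 := by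
  -- If the weight is zero, a diagonal entry is `1`; otherwise an off-diagonal entry is minus the
  -- inverse weight, which needs two points besides `o`.
  by_cases hw : weight V F true = 0
  · intro h0
    have : Nontrivial V := Fintype.one_lt_card_iff_nontrivial.1 (by omega)
    obtain ⟨y, hy⟩ := exists_ne o
    have := congrFun (congrFun h0 y) y
    simp [coavg, hw, block, hy.symm] at this
  · intro h0
    obtain ⟨y, z, hy, hz, hyz⟩ : ∃ y z, o ≠ y ∧ o ≠ z ∧ y ≠ z := by
      classical
      have h3 : 1 < (Finset.univ.erase o).card := by
        rw [Finset.card_erase_of_mem (Finset.mem_univ _), Finset.card_univ]; omega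
      obtain ⟨y, hy, z, hz, hyz⟩ := Finset.one_lt_card.1 h3
      exact ⟨y, z, (Finset.ne_of_mem_erase hy).symm, (Finset.ne_of_mem_erase hz).symm, hyz⟩
    have := congrFun (congrFun h0 y) z
    simp [coavg, hw, block, hy, hz, hyz] at this

theorem coavg_mul_full (hw : weight V F true ≠ 0) (i : Bool) :
    coavg F o * block F o true true i = 0 := by
  rw [coavg, sub_mul, Matrix.smul_mul, block_id_mul, block_full_mul, smul_smul,
    inv_mul_cancel₀ hw, one_smul, sub_self]

theorem full_mul_coavg (hw : weight V F true ≠ 0) (j : Bool) :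
    block F o j true true * coavg F o = 0 := by
  rw [coavg, mul_sub, Matrix.mul_smul, mul_block_id, block_full_mul, smul_smul,
    inv_mul_cancel₀ hw, one_smul, sub_self]

theorem coavg_mul_coavg : coavg F o * coavg F o = coavg F o := by
  by_cases hw : weight V F true = 0
  · simp [coavg, hw, block_id_mul]
  · nth_rewrite 2 [coavg]
    rw [mul_sub, Matrix.mul_smul, coavg_mul_full F o hw, smul_zero, sub_zero, coavg, sub_mul,
      Matrix.smul_mul, block_id_mul, mul_block_id]

theorem block_id_mul_coavg : block F o true false true * coavg F o = coavg F o := by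
  rw [coavg, mul_sub, Matrix.mul_smul, block_id_mul, block_id_mul]

theorem weight_false : weight V F false = 1 := rfl

theorem weight_true_of_not_lt (hV : 2 ≤ Fintype.card V) (h2 : ¬ 2 < Fintype.card V) :
    weight V F true = 1 := by
  have : Fintype.card V = 2 := by omega
  simp only [weight, this, if_true]
  norm_num

/-- The term `b = true` is present only for nonzero weight; `0⁻¹ = 0` makes `coavg` agree when it is
absent. -/
theorem blockD_id (h2 : 2 < Fintype.card V) : blockD F o true false true = coavg F o := by
  classical
  by_cases hw : weight V F true = 0 <;>
    simp [blockD, coavg, odotBit, h2, hw, weight_false, sub_eq_neg_add]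

/-- Outside the exceptional case validity forces `h = odotBit V g i`, so only `b = h` contributes.
-/
theorem blockD_full (hV : 2 ≤ Fintype.card V) {g h i : Bool} (hv : ValidBit V g h i)
    (hw : weight V F h ≠ 0) (hne : ¬ (g = true ∧ h = false ∧ i = true ∧ 2 < Fintype.card V)) :
    blockD F o g h i = (weight V F i)⁻¹ • block F o g true i := by
  classical
  have hw1 := weight_true_of_not_lt F (V := V) hV
  have hid := block_id_eq_full F o
  have hff := block_false_false F o
  cases g <;> cases h <;> cases i <;> by_cases h2 : 2 < Fintype.card V <;>
    simp_all [blockD, ValidBit, odotBit, weight_false]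

theorem block_full {g h i : Bool} (hv : ValidBit V g h i)
    (hne : ¬ (g = true ∧ h = false ∧ i = true ∧ 2 < Fintype.card V)) :
    block F o g h i = block F o g true i := by
  have hid := block_id_eq_full F o
  have hff := block_false_false F o
  cases g <;> cases h <;> cases i <;> by_cases h2 : 2 < Fintype.card V <;>
    simp_all [ValidBit, odotBit]

theorem blockD_eq (hV : 2 ≤ Fintype.card V) {g h i : Bool} (hv : ValidBit V g h i)
    (hw : weight V F h ≠ 0) :
    blockD F o g h i = if g = true ∧ h = false ∧ i = true ∧ 2 < Fintype.card V then coavg F o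
      else (weight V F i)⁻¹ • block F o g true i := by
  split_ifs with hc
  · obtain ⟨rfl, rfl, rfl, h2⟩ := hc
    exact blockD_id F o h2
  · exact blockD_full F o hV hv hw hc

theorem block_eq {g h i : Bool} (hv : ValidBit V g h i) :
    block F o g h i = if g = true ∧ h = false ∧ i = true ∧ 2 < Fintype.card V then
      block F o true false true else block F o g true i := by
  split_ifs with hc
  · obtain ⟨rfl, rfl, rfl, h2⟩ := hc
    rfl
  · exact block_full F o hv hc

/-- The one-coordinate version of `(i ⊕ j) ∪ ((i ∩ j)~ ∩ h)`. -/
def composeBit (V : Type*) [Fintype V] (i j h : Bool) : Bool :=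
  (i ^^ j) || (((i && j) && decide (2 < Fintype.card V)) && h)

variable {F}

theorem blockD_mul_of_ne {l g : Bool} (hlg : l ≠ g) (j k h i : Bool) :
    blockD F o j k l * blockD F o g h i = 0 := by
  classical
  simp only [blockD, Finset.sum_mul, Finset.mul_sum]
  refine Finset.sum_eq_zero fun b _ => Finset.sum_eq_zero fun c _ => ?_
  split_ifs <;> simp [block_mul_of_ne F o hlg]

theorem block_mul_blockD_of_ne {l g : Bool} (hlg : l ≠ g) (j k h i : Bool) :
    block F o j k l * blockD F o g h i = 0 := by
  classical
  simp only [blockD, Finset.mul_sum]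
  refine Finset.sum_eq_zero fun b _ => ?_
  split_ifs <;> simp [block_mul_of_ne F o hlg]

/-- If `i` and `j` differ, then `g` differs from one of them, so `h` or `k` is `true`; if they agree
and the composed digit is `true`, then so is `h`. Either way the weight of `true` is nonzero. -/
theorem composeBit_valid (hV : 2 ≤ Fintype.card V) {j k g h i : Bool}
    (hv : ValidBit V g h i) (hv' : ValidBit V j k g) (hw : weight V F h ≠ 0)
    (hw' : weight V F k ≠ 0) :
    ValidBit V j (composeBit V i j h) i ∧ weight V F (composeBit V i j h) ≠ 0 := by
  have hw1 := weight_true_of_not_lt F (V := V) hV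
  cases j <;> cases k <;> cases g <;> cases h <;> cases i <;>
    by_cases h2 : 2 < Fintype.card V <;>
    simp_all [ValidBit, odotBit, composeBit, weight_false] <;>
    simp_all [not_lt.2 h2, weight_false]

theorem blockD_mul_blockD (hV : 2 ≤ Fintype.card V) {j k g h i : Bool}
    (hv : ValidBit V g h i) (hv' : ValidBit V j k g) (hw : weight V F h ≠ 0)
    (hw' : weight V F k ≠ 0)
    (hc : (((g && i) && decide (2 < Fintype.card V)) && !h) = true → j = true)
    (hk : k = composeBit V g j h) :
    blockD F o j k g * blockD F o g h i = blockD F o j (composeBit V i j h) i := by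
  obtain ⟨hv'', hw''⟩ := composeBit_valid hV hv hv' hw hw'
  rw [blockD_eq F o hV hv hw, blockD_eq F o hV hv' hw', blockD_eq F o hV hv'' hw'']
  have hcc := coavg_mul_coavg F o
  have hbb := block_full_mul F o
  have hw1 := weight_true_of_not_lt F (V := V) hV
  clear hv'' hw''
  by_cases h2 : 2 < Fintype.card V <;>
    [clear hw1; (replace hw1 := hw1 h2)] <;>
    cases j <;> cases k <;> cases g <;> cases h <;> cases i <;>
    -- Each assignment of digits is excluded by the hypotheses or is an instance of the product
    -- rules for `coavg` and full blocks.
    first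
    | (exfalso; revert hv hv' hc hk; simp [ValidBit, odotBit, composeBit, h2]; done)
    | (clear hv hv' hc hk; simp [composeBit, weight_false, smul_smul, *])

/-- Here one factor is `coavg` and the other a full block. Validity makes the digit `h` or `k` of
the full one `true`, so the weight is invertible and the two annihilate. -/
theorem blockD_mul_blockD_eq_zero (hV : 2 ≤ Fintype.card V) {j k g h i : Bool}
    (hv : ValidBit V g h i) (hv' : ValidBit V j k g) (hw : weight V F h ≠ 0)
    (hw' : weight V F k ≠ 0)
    (hc : ¬ (((((g && i) && decide (2 < Fintype.card V)) && !h) = true → j = true) ∧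
      k = composeBit V g j h)) :
    blockD F o j k g * blockD F o g h i = 0 := by
  rw [blockD_eq F o hV hv hw, blockD_eq F o hV hv' hw']
  have hcf := coavg_mul_full F o
  have hfc := full_mul_coavg F o
  have hw1 := weight_true_of_not_lt F (V := V) hV
  by_cases h2 : 2 < Fintype.card V <;>
    [clear hw1; (replace hw1 := hw1 h2)] <;>
    cases j <;> cases k <;> cases g <;> cases h <;> cases i <;>
    first
    | (exfalso; revert hv hv' hc; simp [ValidBit, odotBit, composeBit, h2]; done)
    | (clear hv hv' hc; simp [weight_false, *])

theorem block_mul_blockD (hV : 2 ≤ Fintype.card V) {j k g h i : Bool}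
    (hv : ValidBit V g h i) (hv' : ValidBit V j k g) (hw : weight V F h ≠ 0)
    (hw' : weight V F k ≠ 0)
    (hc : (((g && i) && decide (2 < Fintype.card V)) && k) = true → h = true) :
    block F o j k g * blockD F o g h i =
      weight V F (g && k) • blockD F o j (composeBit V i j h) i := by
  obtain ⟨hv'', hw''⟩ := composeBit_valid hV hv hv' hw hw'
  rw [blockD_eq F o hV hv hw, block_eq F o hv', blockD_eq F o hV hv'' hw'']
  have hcc := block_id_mul_coavg F o
  have hbi := block_id_mul F o
  have hbb := block_full_mul F o
  clear hv'' hw''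
  have hw1 := weight_true_of_not_lt F (V := V) hV
  by_cases h2 : 2 < Fintype.card V <;>
    [clear hw1; (replace hw1 := hw1 h2)] <;>
    cases j <;> cases k <;> cases g <;> cases h <;> cases i <;>
    first
    | (exfalso; revert hv hv' hc; simp [ValidBit, odotBit, h2]; done)
    | (clear hv hv' hc; simp [composeBit, weight_false, smul_smul, *])

theorem block_mul_blockD_eq_zero (hV : 2 ≤ Fintype.card V) {j k g h i : Bool}
    (hv : ValidBit V g h i) (hv' : ValidBit V j k g) (hw : weight V F h ≠ 0)
    (hw' : weight V F k ≠ 0)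
    (hc : ¬ ((((g && i) && decide (2 < Fintype.card V)) && k) = true → h = true)) :
    block F o j k g * blockD F o g h i = 0 := by
  rw [blockD_eq F o hV hv hw, block_eq F o hv']
  have hfc := full_mul_coavg F o
  have hw1 := weight_true_of_not_lt F (V := V) hV
  by_cases h2 : 2 < Fintype.card V <;>
    [clear hw1; (replace hw1 := hw1 h2)] <;>
    cases j <;> cases k <;> cases g <;> cases h <;> cases i <;>
    first
    | (exfalso; revert hv hv' hc; simp [ValidBit, odotBit, h2]; done)
    | (clear hv hv' hc; simp [*])

theorem blockD_ne_zero (hV : 2 ≤ Fintype.card V) {g h i : Bool} (hv : ValidBit V g h i)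
    (hw : weight V F h ≠ 0) : blockD F o g h i ≠ 0 := by
  rw [blockD_eq F o hV hv hw]
  split_ifs with hc
  · exact coavg_ne_zero F o hc.2.2.2
  · have hw1 := weight_true_of_not_lt F (V := V) hV
    refine smul_ne_zero (inv_ne_zero ?_) (block_full_ne_zero F o hV g i)
    cases g <;> cases h <;> cases i <;> by_cases h2 : 2 < Fintype.card V <;>
      simp_all [ValidBit, odotBit, weight_false]

end Block

/-! ### Binary digits and the index operations -/

section Digit

variable {n : ℕ}

/-- The digit of `g` at the position `a`. -/
def digit (g : Fin (2 ^ n)) (a : Fin n) : Bool := decide (a ∈ bits g)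

theorem digit_eq_true {g : Fin (2 ^ n)} {a : Fin n} : digit g a = true ↔ a ∈ bits g := by
  simp [digit]

theorem eq_iff_digit {g h : Fin (2 ^ n)} : g = h ↔ ∀ a, digit g a = digit h a := by
  refine ⟨fun e a => e ▸ rfl, fun e => bits_injective (Finset.ext fun a => ?_)⟩
  rw [← digit_eq_true, ← digit_eq_true, e a]

theorem le2_iff_digit {g h : Fin (2 ^ n)} : LE2 g h ↔ ∀ a, digit g a = true → digit h a = true := by
  simp only [digit_eq_true]
  rfl

theorem digit_ofBits (s : Finset (Fin n)) (a : Fin n) : digit (ofBits s) a = decide (a ∈ s) := by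
  simp [digit, bits_ofBits]

theorem digit_diff (g h : Fin (2 ^ n)) (a : Fin n) :
    digit (diff g h) a = (digit g a && !digit h a) := by
  simp [diff, bits_ofBits, digit]

theorem digit_cup (g h : Fin (2 ^ n)) (a : Fin n) :
    digit (cup g h) a = (digit g a || digit h a) := by
  simp [cup, bits_ofBits, digit]

theorem digit_cap (g h : Fin (2 ^ n)) (a : Fin n) :
    digit (cap g h) a = (digit g a && digit h a) := by
  simp [cap, bits_ofBits, digit]

theorem digit_oplus (g h : Fin (2 ^ n)) (a : Fin n) :
    digit (oplus g h) a = (digit g a ^^ digit h a) := by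
  rw [oplus, digit_cup, digit_diff, digit_diff]
  cases digit g a <;> cases digit h a <;> rfl

theorem digit_tilde (U : Fin n → Type*) [∀ a, Fintype (U a)] (g : Fin (2 ^ n)) (a : Fin n) :
    digit (tilde U g) a = (digit g a && decide (2 < Fintype.card (U a))) := by
  simp [tilde, bits_ofBits, digit]

theorem digit_odot (U : Fin n → Type*) [∀ a, Fintype (U a)] (g h : Fin (2 ^ n)) (a : Fin n) :
    digit (odot U g h) a = odotBit (U a) (digit g a) (digit h a) := by
  rw [odot, digit_cup, digit_oplus, digit_tilde, digit_cap, odotBit]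

/-- The numbers below `2 ^ n` are the families of `n` digits. -/
def digitEquiv (n : ℕ) : Fin (2 ^ n) ≃ (Fin n → Bool) where
  toFun := digit
  invFun f := ofBits (Finset.univ.filter fun a => f a = true)
  left_inv g := eq_iff_digit.2 fun a => by simp [digit_ofBits]
  right_inv f := funext fun a => by simp [digit_ofBits]

theorem sum_prod_digit {R : Type*} [CommSemiring R] (φ : Fin n → Bool → R) :
    ∑ j : Fin (2 ^ n), ∏ a, φ a (digit j a) = ∏ a, ∑ b : Bool, φ a b := by
  classical
  rw [Finset.prod_univ_sum, Fintype.piFinset_univ]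
  exact (digitEquiv n).sum_comp fun f => ∏ a, φ a (f a)

end Digit

/-! ### Tensor products of matrices -/

section Tensor

variable {ι : Type*} [Fintype ι] {U : ι → Type*} {F : Type*} [Field F]

/-- The tensor product of a family of matrices. -/
def tensor (M : ∀ a, Matrix (U a) (U a) F) : Matrix (∀ a, U a) (∀ a, U a) F :=
  Matrix.of fun y z => ∏ a, M a (y a) (z a)

theorem tensor_mul [DecidableEq ι] [∀ a, Fintype (U a)] (M N : ∀ a, Matrix (U a) (U a) F) :
    tensor M * tensor N = tensor fun a => M a * N a := by
  ext y z
  simp only [tensor, Matrix.mul_apply, Matrix.of_apply, ← Finset.prod_mul_distrib]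
  rw [Finset.prod_univ_sum, Fintype.piFinset_univ]

theorem tensor_smul (c : ι → F) (M : ∀ a, Matrix (U a) (U a) F) :
    tensor (fun a => c a • M a) = (∏ a, c a) • tensor M := by
  ext y z
  simp [tensor, Finset.prod_mul_distrib]

theorem tensor_ne_zero_iff (M : ∀ a, Matrix (U a) (U a) F) : tensor M ≠ 0 ↔ ∀ a, M a ≠ 0 := by
  constructor
  · intro h a ha
    refine h ?_
    ext y z
    exact Finset.prod_eq_zero (Finset.mem_univ a) (by simp [ha])
  · intro h h0
    have key : ∀ a, ∃ y z, M a y z ≠ 0 := by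
      intro a
      by_contra! hc
      exact h a (Matrix.ext hc)
    choose y z hyz using key
    exact Finset.prod_ne_zero_iff.2 (fun a _ => hyz a) (congrFun (congrFun h0 y) z)

theorem sum_tensor_digit {n : ℕ} {U : Fin n → Type*}
    (φ : ∀ a, Bool → Matrix (U a) (U a) F) :
    ∑ j : Fin (2 ^ n), tensor (fun a => φ a (digit j a)) = tensor fun a => ∑ b : Bool, φ a b := by
  ext y z
  simp only [Matrix.sum_apply, tensor, Matrix.of_apply]
  exact sum_prod_digit fun a b => φ a b (y a) (z a)

end Tensor

/-! ### Factorization of the scheme, of `B` and of `D` -/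

section Scheme

variable {n : ℕ} {U : Fin n → Type*} [∀ a, Fintype (U a)] (hU : ∀ a, 2 ≤ Fintype.card (U a))

theorem scheme_R (g : Fin (2 ^ n)) (y z : ∀ a, U a) :
    (scheme hU).R g y z ↔ ∀ a, (y a ≠ z a ↔ digit g a = true) := by
  simp only [digit_eq_true]
  rfl

/-- The only case sensitive to the size of `V` is a point different from both of two distinct
points, which needs a third element. -/
theorem exists_common_neighbour_iff {V : Type*} [Fintype V] {g h i : Bool} {y z : V}
    (hV : 2 ≤ Fintype.card V) (hyz : y ≠ z ↔ i = true) :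
    (∃ w, (y ≠ w ↔ g = true) ∧ (w ≠ z ↔ h = true)) ↔ ValidBit V g h i := by
  classical
  have h1 : ∃ w, y ≠ w := by
    have : Nontrivial V := Fintype.one_lt_card_iff_nontrivial.1 hV
    exact (exists_ne y).imp fun _ => Ne.symm
  have h2 : y ≠ z → ((∃ w, y ≠ w ∧ w ≠ z) ↔ 2 < Fintype.card V) := by
    intro hne
    rw [Fintype.two_lt_card_iff]
    constructor
    · rintro ⟨w, hw, hw'⟩
      exact ⟨y, w, z, hw, hne, hw'⟩
    · rintro ⟨b, c, e, hbc, hbe, hce⟩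
      by_contra! hc
      have h3 : ∀ w, w = y ∨ w = z := fun w => by
        by_cases hw : y = w
        · exact Or.inl hw.symm
        · exact Or.inr (hc w hw)
      rcases h3 b with rfl | rfl <;> rcases h3 c with rfl | rfl <;> rcases h3 e with rfl | rfl <;>
        simp_all
  cases i
  · have hyz' : y = z := by simpa using hyz
    subst hyz'
    cases g <;> cases h <;> simp_all [ValidBit, odotBit, eq_comm]
  · have hyz' : y ≠ z := by simpa using hyz
    cases g <;> cases h <;> simp_all [ValidBit, odotBit, eq_comm]

theorem interNum_ne_zero_iff (g h i : Fin (2 ^ n)) :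
    (scheme hU).interNum g h i ≠ 0 ↔ ∀ a, ValidBit (U a) (digit g a) (digit h a) (digit i a) := by
  obtain ⟨y, z, hyz⟩ := (scheme hU).nonempty i
  rw [AssociationScheme.interNum_eq _ hyz, Nat.card_ne_zero, and_iff_left Subtype.finite,
    nonempty_subtype]
  simp only [scheme_R] at hyz ⊢
  simp only [← exists_common_neighbour_iff (hU _) (hyz _), ← forall_and]
  refine ⟨fun ⟨w, hw⟩ a => ⟨w a, hw a⟩, fun hw => ?_⟩
  choose w hw using hw
  exact ⟨w, hw⟩

variable (F : Type*) [Field F]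

theorem cast_valency (g : Fin (2 ^ n)) :
    (((scheme hU).valency g : ℕ) : F) = ∏ a, weight (U a) F (digit g a) := by
  classical
  obtain ⟨y, -, -⟩ := (scheme hU).nonempty 0
  have hc : (scheme hU).R 0 y y := ((scheme hU).diag y y).2 rfl
  rw [AssociationScheme.valency, AssociationScheme.interNum_eq _ hc]
  have hconv := ((scheme hU).converse g).choose_spec
  have e : {w // (scheme hU).R g y w ∧ (scheme hU).R ((scheme hU).conv g) w y} ≃
      ∀ a, {w : U a // y a ≠ w ↔ digit g a = true} :=
    (Equiv.subtypeEquivRight fun w => by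
      rw [AssociationScheme.conv, hconv, and_self, scheme_R]).trans Equiv.subtypePiEquivPi
  rw [Nat.card_congr e, Nat.card_pi, Nat.cast_prod]
  refine Finset.prod_congr rfl fun a _ => ?_
  rw [← sum_sphere F (y a), Finset.sum_boole, Nat.card_eq_fintype_card, Fintype.card_subtype]

theorem ite_forall_eq_prod {ι : Type*} [Fintype ι] {P : ι → Prop} [DecidablePred P]
    [Decidable (∀ i, P i)] : (if ∀ i, P i then (1 : F) else 0) = ∏ i, if P i then 1 else 0 := by
  split_ifs with hc
  · exact (Finset.prod_eq_one fun i _ => if_pos (hc i)).symm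
  · obtain ⟨i, hi⟩ := not_forall.1 hc
    exact (Finset.prod_eq_zero (Finset.mem_univ i) (if_neg hi)).symm

variable (x : ∀ a, U a)

theorem B_eq_tensor (g h i : Fin (2 ^ n)) :
    B hU F x g h i = tensor fun a => block F (x a) (digit g a) (digit h a) (digit i a) := by
  classical
  ext y z
  simp only [B, Matrix.sum_apply, AssociationScheme.dualIdem, AssociationScheme.adj,
    Matrix.diagonal_mul, Matrix.mul_diagonal, Matrix.of_apply, tensor, block]
  obtain ⟨j, hj, hju⟩ := (scheme hU).partition y z
  -- Only the relation containing `(y, z)` contributes to this entry.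
  rw [Finset.sum_filter, Finset.sum_eq_single j]
  · rw [ite_zero_mul_ite_zero, ite_zero_mul_ite_zero, one_mul, one_mul, ← ite_and]
    refine (if_congr ?_ rfl rfl).trans (ite_forall_eq_prod F)
    simp only [scheme_R, le2_iff_digit, digit_oplus] at hj ⊢
    simp only [← forall_and]
    refine forall_congr' fun a => ?_
    have := hj a
    by_cases h1 : x a = y a <;> by_cases h2 : x a = z a <;> cases digit g a <;>
      cases digit i a <;> by_cases h3 : y a = z a <;> simp_all
  · intro k _ hk
    have : ¬ (scheme hU).R k y z := fun hc => hk (hju k hc)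
    simp [this]
  · simp

variable (p : ℕ) [CharP F p]

theorem not_dvd_valency_iff (g : Fin (2 ^ n)) :
    ¬ p ∣ (scheme hU).valency g ↔ ∀ a, weight (U a) F (digit g a) ≠ 0 := by
  rw [← CharP.cast_eq_zero_iff F p, cast_valency, Finset.prod_eq_zero_iff]
  simp

theorem prod_sign_digit {h m : Fin (2 ^ n)} (hm : LE2 h m) :
    ∏ a, (if digit m a = true ∧ digit h a = false then (-1 : F) else 1) =
      (-1) ^ ((bits m).card - (bits h).card) := by
  classical
  rw [← Finset.card_sdiff_of_subset hm, Finset.prod_ite, Finset.prod_const, Finset.prod_const_one,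
    mul_one]
  congr 2
  ext a
  simp [digit]

/-- The layers only sort the indices `m` by size. The bound on `k` loses none: `p ∤ k_m` keeps
positions with `u_a ≡ 1` out of `m`. -/
theorem D_eq_sum (g h i : Fin (2 ^ n)) [DecidablePred fun m : Fin (2 ^ n) =>
      LE2 h m ∧ LE2 m (odot U g i) ∧ ¬ p ∣ (scheme hU).valency m] :
    D hU F x p g h i =
      ∑ m ∈ Finset.univ.filter fun m => LE2 h m ∧ LE2 m (odot U g i) ∧
          ¬ p ∣ (scheme hU).valency m,
        ((-1 : F) ^ ((bits m).card - (bits h).card) *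
          (((scheme hU).valency (cap i m) : ℕ) : F)⁻¹) • B hU F x g m i := by
  classical
  rw [D, ← Finset.sum_fiberwise_of_maps_to (t := Finset.range (numFree U p h (odot U g i) + 1))
    (g := fun m => (bits m).card - (bits h).card)]
  · refine Finset.sum_congr rfl fun k _ => ?_
    have : layer hU p h (odot U g i) k = Finset.filter (fun m => (bits m).card - (bits h).card = k)
        (Finset.univ.filter fun m => LE2 h m ∧ LE2 m (odot U g i) ∧
          ¬ p ∣ (scheme hU).valency m) := by
      ext m
      simp only [layer, Finset.mem_filter, Finset.mem_univ, true_and, and_assoc]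
      refine and_congr_right fun h1 => and_congr_right fun _ => and_congr_right fun _ => ?_
      have := Finset.card_le_card h1
      omega
    rw [this]
    refine Finset.sum_congr rfl fun m hm => ?_
    rw [(Finset.mem_filter.1 hm).2]
  · intro m hm
    obtain ⟨h1, h2, h3⟩ := (Finset.mem_filter.1 hm).2
    rw [Finset.mem_range, Nat.lt_succ_iff, ← Finset.card_sdiff_of_subset h1, numFree]
    refine Finset.card_le_card fun a ha => ?_
    rw [Finset.mem_sdiff] at ha
    rw [Finset.mem_filter, Finset.mem_sdiff, ← CharP.natCast_eq_natCast F p, Nat.cast_one]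
    refine ⟨⟨h2 ha.1, ha.2⟩, fun hc => ?_⟩
    have := (not_dvd_valency_iff hU F p m).1 h3 a
    rw [digit_eq_true.2 ha.1] at this
    simp [weight, hc] at this

theorem D_eq_tensor (g h i : Fin (2 ^ n)) :
    D hU F x p g h i = tensor fun a => blockD F (x a) (digit g a) (digit h a) (digit i a) := by
  classical
  simp only [blockD]
  rw [D_eq_sum, ← sum_tensor_digit, Finset.sum_filter]
  refine Finset.sum_congr rfl fun m _ => ?_
  have hiff : LE2 h m ∧ LE2 m (odot U g i) ∧ ¬ p ∣ (scheme hU).valency m ↔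
      ∀ a, (digit h a = true → digit m a = true) ∧
        (digit m a = true → odotBit (U a) (digit g a) (digit i a) = true) ∧
        weight (U a) F (digit m a) ≠ 0 := by
    simp only [le2_iff_digit, not_dvd_valency_iff hU F p, digit_odot, ← forall_and]
  rw [if_congr hiff rfl rfl]
  split_ifs with hc
  · rw [← prod_sign_digit F (le2_iff_digit.2 fun a => (hc a).1), cast_valency, B_eq_tensor,
      ← Finset.prod_inv_distrib, ← Finset.prod_mul_distrib, ← tensor_smul]
    congr 1
    funext a
    rw [if_pos (hc a), digit_cap]
  -- An inadmissible `m` fails at some coordinate, where the tensor factor is zero.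
  · by_contra hne
    refine hc fun a => ?_
    by_contra ha
    exact (tensor_ne_zero_iff _).1 (Ne.symm hne) a (if_neg ha)

end Scheme

end Factorial

/-! ### Assembly of the coordinatewise rules -/

theorem theorem8p10 {n : ℕ} (hn : 0 < n) {U : Fin n → Type*} [∀ a, Fintype (U a)]
    (hU : ∀ a, 2 ≤ Fintype.card (U a)) {F : Type*} [Field F] (p : ℕ) [CharP F p]
    (x : ∀ a, U a) (g h i j k l m : Fin (2 ^ n))
    (hm : m = cup (oplus i j) (cap (tilde U (cap i j)) h))
    (hghi : (scheme hU).interNum g h i ≠ 0) (hjkl : (scheme hU).interNum j k l ≠ 0)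
    (hp : ¬ p ∣ (scheme hU).valency h * (scheme hU).valency k) :
    -- the product of two elements `D`
    (D hU F x p j k l * D hU F x p g h i ≠ 0 ↔
      g = l ∧ LE2 (diff (tilde U (cap g i)) h) j ∧
        k = cup (oplus g j) (cap (tilde U (cap g j)) h)) ∧
    (g = l ∧ LE2 (diff (tilde U (cap g i)) h) j ∧
        k = cup (oplus g j) (cap (tilde U (cap g j)) h) →
      DDefined hU p j m i ∧ D hU F x p j k g * D hU F x p g h i = D hU F x p j m i) ∧
    -- the companion statement for the product of an element `B` and an element `D`
    (B hU F x j k l * D hU F x p g h i ≠ 0 ↔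
      g = l ∧ LE2 (cap (tilde U (cap g i)) k) h) ∧
    (g = l ∧ LE2 (cap (tilde U (cap g i)) k) h →
      DDefined hU p j m i ∧
        B hU F x j k g * D hU F x p g h i =
          (((scheme hU).valency (cap g k) : ℕ) : F) • D hU F x p j m i) := by
  classical
  have hph := (not_dvd_valency_iff hU F p h).1 fun hd => hp (hd.mul_right _)
  have hpk := (not_dvd_valency_iff hU F p k).1 fun hd => hp (hd.mul_left _)
  rw [interNum_ne_zero_iff] at hghi hjkl
  have hmd : ∀ a, digit m a = composeBit (U a) (digit i a) (digit j a) (digit h a) := fun a => by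
    rw [hm, digit_cup, digit_oplus, digit_cap, digit_tilde, digit_cap, composeBit]
  have hkd : k = cup (oplus g j) (cap (tilde U (cap g j)) h) ↔
      ∀ a, digit k a = composeBit (U a) (digit g a) (digit j a) (digit h a) := by
    simp only [eq_iff_digit, digit_cup, digit_oplus, digit_cap, digit_tilde, composeBit]
  have hcD : LE2 (diff (tilde U (cap g i)) h) j ↔ ∀ a, (((digit g a && digit i a) &&
      decide (2 < Fintype.card (U a))) && !digit h a) = true → digit j a = true := by
    simp only [le2_iff_digit, digit_diff, digit_cap, digit_tilde]
  have hcB : LE2 (cap (tilde U (cap g i)) k) h ↔ ∀ a, (((digit g a && digit i a) &&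
      decide (2 < Fintype.card (U a))) && digit k a) = true → digit h a = true := by
    simp only [le2_iff_digit, digit_cap, digit_tilde]
  rw [hkd, hcD, hcB, DDefined, interNum_ne_zero_iff, not_dvd_valency_iff hU F p]
  simp only [D_eq_tensor, B_eq_tensor, tensor_mul, hmd]
  by_cases hgl : g = l
  swap
  -- At a digit where `g` and `l` differ the inner spheres are disjoint, so that factor is zero.
  · obtain ⟨a, ha⟩ := not_forall.1 (mt eq_iff_digit.2 (Ne.symm hgl))
    simp only [hgl, false_and, false_imp_iff, and_true, true_and, iff_false, not_not]
    constructor <;> by_contra hne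
    · exact (tensor_ne_zero_iff _).1 hne a (blockD_mul_of_ne (x a) ha _ _ _ _)
    · exact (tensor_ne_zero_iff _).1 hne a (block_mul_blockD_of_ne (x a) ha _ _ _ _)
  subst hgl
  have hval := fun a => composeBit_valid (hU a) (hghi a) (hjkl a) (hph a) (hpk a)
  have hdef : (∀ a, ValidBit (U a) (digit j a)
      (composeBit (U a) (digit i a) (digit j a) (digit h a)) (digit i a)) ∧
      ∀ a, weight (U a) F (composeBit (U a) (digit i a) (digit j a) (digit h a)) ≠ 0 :=
    forall_and.1 hval
  have hne := fun a => blockD_ne_zero (x a) (hU a) (hval a).1 (hval a).2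
  simp only [true_and, tensor_ne_zero_iff, ← forall_and]
  refine ⟨forall_congr' fun a => ⟨fun h0 => ?_, fun hc => ?_⟩, fun hc => ⟨hval, ?_⟩,
    forall_congr' fun a => ⟨fun h0 => ?_, fun hc => ?_⟩, fun hc => ⟨hval, ?_⟩⟩
  · by_contra hc
    exact h0 (blockD_mul_blockD_eq_zero (x a) (hU a) (hghi a) (hjkl a) (hph a) (hpk a) hc)
  · rw [blockD_mul_blockD (x a) (hU a) (hghi a) (hjkl a) (hph a) (hpk a) hc.1 hc.2]
    exact hne a
  · congr 1
    funext a
    exact blockD_mul_blockD (x a) (hU a) (hghi a) (hjkl a) (hph a) (hpk a) (hc a).1 (hc a).2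
  · by_contra hc
    exact h0 (block_mul_blockD_eq_zero (x a) (hU a) (hghi a) (hjkl a) (hph a) (hpk a) hc)
  · rw [block_mul_blockD (x a) (hU a) (hghi a) (hjkl a) (hph a) (hpk a) hc]
    refine smul_ne_zero ?_ (hne a)
    -- The scalar is `1` or the weight of the digit of `k`, which is nonzero.
    have := hpk a
    cases digit g a
    · simp [weight_false]
    · simpa using this
  · rw [cast_valency, ← tensor_smul]
    congr 1
    funext a
    rw [digit_cap]
    exact block_mul_blockD (x a) (hU a) (hghi a) (hjkl a) (hph a) (hpk a) (hc a)
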